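/- Let $p\in(0,1]$. For a positive integer $n$, let $T_n$ be the rooted infinite complete $n$-ary tree, give its edges independent labels uniformly distributed in $[0,1]$, let the label of a non-root vertex be the label of the edge joining it to its parent, and give the root the label $p$. The $p$-percolated uniform temporal tree $\mathcal{T}_{n,p}$ consists of those vertices of $T_n$ for which the vertex labels along the path from the root are decreasing; it is almost surely finite, and $|\mathcal{T}_{n,p}|$ denotes its number of vertices. Let $D_{n,p}$ denote the depth (the distance from the root) of a vertex of $\mathcal{T}_{n,p}$ that, conditionally on the labels, is chosen uniformly at random among the vertices of $\mathcal{T}_{n,p}$. Then, as $n\to\infty$, $$\frac{D_{n,p}}{np}\to 1 \quad\text{and}\quad \frac{D_{n,p}}{\log|\mathcal{T}_{n,p}|}\to 1 \qquad\text{in probability.}$$ -/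

import Mathlib

open MeasureTheory ProbabilityTheory Filter Topology

namespace UniformTemporalTree

/-- Vertices of the rooted infinite complete `n`-ary tree, as finite words over `Fin n`: the root is
the empty word `[]`, the children of `v` are the words `i :: v` with `i : Fin n`, and the depth of
`v` (its number of edges from the root) is the length of the word. -/
abbrev Vertex (n : ℕ) : Type := List (Fin n)

/-- There are countably many vertices, and every set of vertices is an event. -/
instance instMeasurableSpaceVertex (n : ℕ) : MeasurableSpace (Vertex n) := ⊤

instance instDiscreteMeasurableSpaceVertex (n : ℕ) : DiscreteMeasurableSpace (Vertex n) :=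
  ⟨fun _ => trivial⟩

/-- Edges of the complete `n`-ary tree: `(v, i)` is the edge joining `v` to its child `i :: v`. -/
abbrev Edge (n : ℕ) : Type := Vertex n × Fin n

/-- The depth of a vertex: its number of edges from the root. -/
def depth {n : ℕ} (v : Vertex n) : ℕ := v.length

/-- The label of a vertex, given labels `u` of the edges: the root has label `p`, and any other
vertex carries the label of the edge to its parent. -/
def vertexLabel {n : ℕ} (p : ℝ) (u : Edge n → ℝ) : Vertex n → ℝ
  | [] => p
  | i :: v => u (v, i)

/-- The vertex labels along the path from the root to the given vertex are decreasing. -/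
def HasDecreasingPath {n : ℕ} (p : ℝ) (u : Edge n → ℝ) : Vertex n → Prop
  | [] => True
  | i :: v => vertexLabel p u (i :: v) < vertexLabel p u v ∧ HasDecreasingPath p u v

/-- The vertex set of the `p`-percolated temporal tree determined by the edge labels `u`. -/
def temporalTree {n : ℕ} (p : ℝ) (u : Edge n → ℝ) : Set (Vertex n) :=
  {v | HasDecreasingPath p u v}

/-- `U` is a family of independent random edge labels, each uniformly distributed in `[0,1]`. -/
structure IsUniformLabelling {n : ℕ} {Ω : Type*} [MeasurableSpace Ω] (μ : Measure Ω)
    (U : Ω → Edge n → ℝ) : Prop where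
  measurable : Measurable U
  indep : iIndepFun (fun e ω => U ω e) μ
  uniform : ∀ e, pdf.IsUniform (fun ω => U ω e) (Set.Icc 0 1) μ volume

/-- `V` is a uniformly chosen vertex of the `p`-percolated temporal tree with edge labels `U`:
the conditional law of `V` given the edge labels is the uniform distribution on the vertices of the
tree, that is, `μ (U ∈ B, V = v)` is the integral over `{U ∈ B}` of the probability that the
uniform distribution on the tree gives to `v`. -/
structure IsUniformVertex {n : ℕ} {Ω : Type*} [MeasurableSpace Ω] (p : ℝ) (μ : Measure Ω)
    (U : Ω → Edge n → ℝ) (V : Ω → Vertex n) : Prop where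
  measurable : Measurable V
  condLaw : ∀ (B : Set (Edge n → ℝ)), MeasurableSet B → ∀ v : Vertex n,
    μ (U ⁻¹' B ∩ V ⁻¹' {v}) = ∫⁻ ω in U ⁻¹' B, uniformOn (temporalTree p (U ω)) {v} ∂μ

/-- Convergence in probability to a constant `c` of real random variables `X n`, where each `X n`
may live on a probability space of its own. -/
def TendstoInProbability {Ω : ℕ → Type*} [∀ n, MeasurableSpace (Ω n)] (μ : ∀ n, Measure (Ω n))
    (X : ∀ n, Ω n → ℝ) (c : ℝ) : Prop :=
  ∀ ε : ℝ, 0 < ε → Tendsto (fun n => μ n {ω | ε ≤ |X n ω - c|}) atTop (𝓝 0)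

end UniformTemporalTree

namespace UniformTemporalTree

open scoped ENNReal

/-! Write `m = n * p`. A vertex of depth `k` belongs to the tree when `k` independent uniform labels
decrease below `p`, so the expected number of vertices at depth `k` is `m ^ k / k!`
(`lintegral_weight_single`). The mean size is thus `exp m`, and the mean profile is `exp m` times
the Poisson law of mean `m`, which concentrates at `m`: depths off by a factor `ε` carry an
exponentially smaller mean count (`lintegral_weight_deviation_le`).

Passing from mean counts to a uniform vertex requires that the size is rarely much below its mean.
Splitting at the root gives an integral equation for the Laplace transform of the size, and a
differential inequality bounds it by `1 / (1 + t * exp m)`, the transform of an exponential variable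
of mean `exp m`. Hence the size is below `exp (m - s)` with probability at most `exp (1 - s)`
(`labellingLaw_weight_le`).

Dividing the mean count of bad vertices by this typical size gives the first limit. Markov's
inequality bounds the size above, so its logarithm is close to `m`, and the second limit follows. -/

/-- The uniform distribution on `[0,1]`. -/
noncomputable def labelLaw : Measure ℝ := volume.restrict (Set.Icc 0 1)

instance : IsProbabilityMeasure labelLaw := ⟨by simp [labelLaw]⟩

/-- The law of a family of independent uniform edge labels. -/
noncomputable def labellingLaw (n : ℕ) : Measure (Edge n → ℝ) :=
  Measure.infinitePi fun _ => labelLaw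

instance (n : ℕ) : IsProbabilityMeasure (labellingLaw n) := by
  unfold labellingLaw; infer_instance

theorem IsUniformLabelling.map_eq {n : ℕ} {Ω : Type*} [MeasurableSpace Ω] {μ : Measure Ω}
    {U : Ω → Edge n → ℝ} (h : IsUniformLabelling μ U) : μ.map U = labellingLaw n := by
  have hm : ∀ e, Measurable (fun ω => U ω e) := fun e => (measurable_pi_apply e).comp h.measurable
  have h1 := h.indep.map_fun_eq_infinitePi_map hm
  have h2 : ∀ e, μ.map (fun ω => U ω e) = labelLaw := by
    intro e
    have := h.uniform e
    unfold pdf.IsUniform at this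
    rw [this, labelLaw, ProbabilityTheory.cond]
    simp
  simp_rw [h2] at h1
  exact h1

/-! ### Independence and self-similarity of the branches at the root. -/

/-- The labels of the subtree rooted at the `i`-th child of the root. -/
def subLabels {n : ℕ} (i : Fin n) (u : Edge n → ℝ) : Edge n → ℝ := fun e => u (e.1 ++ [i], e.2)

theorem measurable_subLabels {n : ℕ} (i : Fin n) : Measurable (subLabels i) :=
  measurable_pi_iff.2 fun _ => measurable_pi_apply _

/-- The edges at or below the `i`-th edge of the root, indexed by that edge and the edges of the
subtree below it. -/
def branchEdge {n : ℕ} (q : Fin n × Option (Edge n)) : Edge n :=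
  match q.2 with
  | none => ([], q.1)
  | some e => (e.1 ++ [q.1], e.2)

theorem branchEdge_injective {n : ℕ} : Function.Injective (branchEdge (n := n)) := by
  rintro ⟨i, o⟩ ⟨j, o'⟩ h
  rcases o with _ | ⟨v, a⟩ <;> rcases o' with _ | ⟨w, b⟩ <;> simp [branchEdge] at h ⊢
  · exact h
  · obtain ⟨h1, h2⟩ := h
    exact ⟨h1.2, h1.1, h2⟩

theorem labellingLaw_map_branch (n : ℕ) :
    (labellingLaw n).map (fun u (i : Fin n) (o : Option (Edge n)) => u (branchEdge (i, o))) =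
      Measure.infinitePi fun _ => Measure.infinitePi fun _ => labelLaw := by
  have h1 := Measure.map_infinitePi_infinitePi_of_inj (P := fun _ : Edge n => labelLaw)
    (branchEdge_injective (n := n))
  have h2 := Measure.infinitePi_map_curry (ι := Fin n) (κ := Option (Edge n))
    (fun _ _ => labelLaw)
  rw [← h1, Measure.map_map (by fun_prop) (by fun_prop)] at h2
  exact h2

/-- This separates the label of a root edge (`none`) from the labels of the subtree below it (`some
e`). A product measure is determined by finite boxes, and there the factor at `none` splits off. -/
theorem map_option_elim_prod {ι : Type*} {X : Type*} [MeasurableSpace X] (ν : Measure X)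
    [IsProbabilityMeasure ν] :
    (ν.prod (Measure.infinitePi fun _ : ι => ν)).map (fun x (o : Option ι) => o.elim x.1 x.2) =
      Measure.infinitePi fun _ : Option ι => ν := by
  classical
  apply Measure.eq_infinitePi
  intro s t ht
  have hm : Measurable (fun (x : X × (ι → X)) (o : Option ι) => o.elim x.1 x.2) := by
    refine measurable_pi_iff.2 fun o => ?_
    cases o with
    | none => exact measurable_fst
    | some i => exact (measurable_pi_apply i).comp measurable_snd
  rw [Measure.map_apply hm (.pi (Finset.countable_toSet _) fun _ _ => ht _)]
  have hpre : (fun (x : X × (ι → X)) (o : Option ι) => o.elim x.1 x.2) ⁻¹' Set.pi s t =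
      (if none ∈ s then t none else Set.univ) ×ˢ
        Set.pi (Finset.eraseNone s) (fun i => t (some i)) := by
    ext ⟨a, w⟩
    simp only [Set.mem_preimage, Set.mem_pi, Finset.mem_coe, Set.mem_prod, Finset.mem_eraseNone]
    constructor
    · intro h
      refine ⟨?_, fun i hi => h (some i) hi⟩
      split_ifs with h0
      · exact h none h0
      · trivial
    · rintro ⟨h1, h2⟩ o ho
      cases o with
      | none => simpa [ho] using h1
      | some i => exact h2 i ho
  rw [hpre, Measure.prod_prod, Measure.infinitePi_pi _ (fun _ _ => ht _)]
  have hs : ∏ i ∈ Finset.eraseNone s, ν (t (some i)) = ∏ o ∈ s.erase none, ν (t o) := by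
    rw [← Finset.map_some_eraseNone, Finset.prod_map]; rfl
  rw [hs]
  split_ifs with h0
  · rw [Finset.mul_prod_erase s (fun o => ν (t o)) h0]
  · simp [Finset.erase_eq_of_notMem h0]

variable {n : ℕ}

theorem iIndepFun_branch :
    iIndepFun (fun (i : Fin n) (u : Edge n → ℝ) (o : Option (Edge n)) => u (branchEdge (i, o)))
      (labellingLaw n) := by
  have hm : ∀ i : Fin n, Measurable
      (fun (u : Edge n → ℝ) (o : Option (Edge n)) => u (branchEdge (i, o))) := by
    intro i; fun_prop
  rw [iIndepFun_iff_map_fun_eq_infinitePi_map hm, labellingLaw_map_branch]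
  congr 1
  funext i
  rw [← Measure.infinitePi_map_eval (fun _ : Fin n => Measure.infinitePi
    (fun _ : Option (Edge n) => labelLaw)) i, ← labellingLaw_map_branch,
    Measure.map_map (by fun_prop) (by fun_prop)]
  rfl

theorem labellingLaw_map_branch_apply (i : Fin n) :
    (labellingLaw n).map (fun u (o : Option (Edge n)) => u (branchEdge (i, o))) =
      Measure.infinitePi fun _ => labelLaw := by
  rw [← Measure.infinitePi_map_eval (fun _ : Fin n => Measure.infinitePi
    (fun _ : Option (Edge n) => labelLaw)) i, ← labellingLaw_map_branch,
    Measure.map_map (by fun_prop) (by fun_prop)]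
  rfl

theorem measurePreserving_branch (i : Fin n) :
    MeasurePreserving (fun u : Edge n → ℝ => (u ([], i), subLabels i u)) (labellingLaw n)
      (labelLaw.prod (labellingLaw n)) := by
  have hm : Measurable (fun u : Edge n → ℝ => (u ([], i), subLabels i u)) :=
    (measurable_pi_apply _).prodMk (measurable_subLabels i)
  refine ⟨hm, ?_⟩
  have hm' : Measurable (fun (x : ℝ × (Edge n → ℝ)) (o : Option (Edge n)) => o.elim x.1 x.2) := by
    refine measurable_pi_iff.2 fun o => ?_
    cases o with
    | none => exact measurable_fst
    | some i => exact (measurable_pi_apply i).comp measurable_snd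
  have h1 := map_option_elim_prod (ι := Edge n) labelLaw
  rw [← labellingLaw_map_branch_apply i] at h1
  have h2 := congrArg (Measure.map (fun w : Option (Edge n) → ℝ => (w none, fun e => w (some e)))) h1
  rw [Measure.map_map (by fun_prop) hm', Measure.map_map (by fun_prop) (by fun_prop)] at h2
  simp only [Function.comp_def, Option.elim, Prod.mk.eta] at h2
  rw [Measure.map_id'] at h2
  exact h2.symm

theorem lintegral_branch {F : ℝ × (Edge n → ℝ) → ℝ≥0∞} (hF : Measurable F) (i : Fin n) :
    ∫⁻ u, F (u ([], i), subLabels i u) ∂labellingLaw n =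
      ∫⁻ a, ∫⁻ w, F (a, w) ∂labellingLaw n ∂labelLaw := by
  rw [(measurePreserving_branch i).lintegral_comp hF, lintegral_prod _ hF.aemeasurable]

theorem lintegral_sum_branch {F : ℝ × (Edge n → ℝ) → ℝ≥0∞} (hF : Measurable F) :
    ∫⁻ u, ∑ i, F (u ([], i), subLabels i u) ∂labellingLaw n =
      n * ∫⁻ a, ∫⁻ w, F (a, w) ∂labellingLaw n ∂labelLaw := by
  rw [lintegral_finsetSum (f := fun i u => F (u ([], i), subLabels i u)) _ fun i _ =>
    hF.comp (measurePreserving_branch i).measurable]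
  simp [lintegral_branch hF]

theorem lintegral_prod_branch {F : ℝ × (Edge n → ℝ) → ℝ≥0∞} (hF : Measurable F) :
    ∫⁻ u, ∏ i, F (u ([], i), subLabels i u) ∂labellingLaw n =
      (∫⁻ a, ∫⁻ w, F (a, w) ∂labellingLaw n ∂labelLaw) ^ n := by
  rw [lintegral_prod_eq_prod_lintegral_of_indepFun Finset.univ
    (fun i u => F (u ([], i), subLabels i u))]
  · simp [lintegral_branch hF]
  · exact iIndepFun_branch.comp
      (fun _ w => F (w none, fun e => w (some e))) fun _ => hF.comp (by fun_prop)
  · exact fun i => hF.comp (measurePreserving_branch i).measurable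

/-- Words grow towards the leaves at their head, so the last letter is the first step from the root;
decomposing at the root means appending. -/
theorem vertexLabel_append_singleton (p : ℝ) (u : Edge n → ℝ) (v : Vertex n) (i : Fin n) :
    vertexLabel p u (v ++ [i]) = vertexLabel (u ([], i)) (subLabels i u) v := by
  cases v <;> rfl

theorem hasDecreasingPath_append_singleton (p : ℝ) (u : Edge n → ℝ) (v : Vertex n) (i : Fin n) :
    HasDecreasingPath p u (v ++ [i]) ↔
      u ([], i) < p ∧ HasDecreasingPath (u ([], i)) (subLabels i u) v := by
  induction v with
  | nil => simp [HasDecreasingPath, vertexLabel]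
  | cons j w ih =>
    rw [List.cons_append, HasDecreasingPath, ih, HasDecreasingPath, vertexLabel_append_singleton]
    simp only [vertexLabel, subLabels]
    tauto

theorem measurableSet_hasDecreasingPath (v : Vertex n) :
    MeasurableSet {x : ℝ × (Edge n → ℝ) | HasDecreasingPath x.1 x.2 v} := by
  induction v with
  | nil => simp [HasDecreasingPath]
  | cons j w ih =>
    have h1 : Measurable fun x : ℝ × (Edge n → ℝ) => vertexLabel x.1 x.2 (j :: w) :=
      (measurable_pi_apply (w, j)).comp measurable_snd
    have h2 : Measurable fun x : ℝ × (Edge n → ℝ) => vertexLabel x.1 x.2 w := by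
      cases w with
      | nil => exact measurable_fst
      | cons k w => exact (measurable_pi_apply (w, k)).comp measurable_snd
    exact (measurableSet_lt h1 h2).inter ih

/-! ### Weighted vertex counts and their recursion at the root. -/

/-- The total weight of the vertices of the tree, where a vertex of depth `k` has weight `g k`. -/
noncomputable def weight (g : ℕ → ℝ≥0∞) (p : ℝ) (u : Edge n → ℝ) : ℝ≥0∞ :=
  ∑' v : Vertex n, (temporalTree p u).indicator (fun v => g (depth v)) v

theorem measurable_weight (g : ℕ → ℝ≥0∞) :
    Measurable fun x : ℝ × (Edge n → ℝ) => weight g x.1 x.2 := by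
  refine Measurable.tsum fun v => ?_
  exact Measurable.ite (measurableSet_hasDecreasingPath v) measurable_const measurable_const

theorem measurable_weight_right (g : ℕ → ℝ≥0∞) (p : ℝ) :
    Measurable (weight g p : (Edge n → ℝ) → ℝ≥0∞) :=
  (measurable_weight g).comp measurable_prodMk_left

theorem tsum_list_eq_add_sum (f : List (Fin n) → ℝ≥0∞) :
    ∑' v, f v = f [] + ∑ i, ∑' v, f (v ++ [i]) := by
  let e : Unit ⊕ (Fin n × List (Fin n)) → List (Fin n) :=
    Sum.elim (fun _ => []) fun x => x.2 ++ [x.1]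
  have he : Function.Bijective e := by
    constructor
    · rintro (_ | ⟨i, v⟩) (_ | ⟨j, w⟩) h <;> simp [e] at h ⊢
      exact ⟨h.2, h.1⟩
    · intro v
      rcases List.eq_nil_or_concat v with rfl | ⟨w, i, rfl⟩
      · exact ⟨Sum.inl (), rfl⟩
      · exact ⟨Sum.inr (i, w), by simp [e]⟩
  rw [← (Equiv.ofBijective e he).tsum_eq f, ENNReal.summable.tsum_sum ENNReal.summable,
    tsum_fintype]
  simp only [e, Equiv.ofBijective_apply, Sum.elim_inl, Sum.elim_inr]
  rw [ENNReal.tsum_prod (f := fun i v => f (v ++ [i])), tsum_fintype]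
  simp

theorem weight_eq_add_sum (g : ℕ → ℝ≥0∞) (p : ℝ) (u : Edge n → ℝ) :
    weight g p u = g 0 + ∑ i, if u ([], i) < p then
      weight (fun k => g (k + 1)) (u ([], i)) (subLabels i u) else 0 := by
  classical
  rw [weight, tsum_list_eq_add_sum]
  congr 1
  · rw [Set.indicator_of_mem (show [] ∈ temporalTree p u from trivial)]; rfl
  · refine Finset.sum_congr rfl fun i _ => ?_
    have : ∀ v : Vertex n, (temporalTree p u).indicator (fun v => g (depth v)) (v ++ [i]) =
        if u ([], i) < p then (temporalTree (u ([], i)) (subLabels i u)).indicator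
          (fun v => g (depth v + 1)) v else 0 := by
      intro v
      simp only [Set.indicator_apply, temporalTree, Set.mem_ofPred_eq,
        hasDecreasingPath_append_singleton, depth, List.length_append, List.length_singleton,
        ite_and]
    simp_rw [this]
    split_ifs <;> simp [weight]

theorem weight_eq_tsum (g : ℕ → ℝ≥0∞) (p : ℝ) (u : Edge n → ℝ) :
    weight g p u = ∑' k, g k * weight (Pi.single k 1) p u := by
  simp_rw [weight, ← ENNReal.tsum_mul_left]
  rw [ENNReal.tsum_comm]
  refine tsum_congr fun v => ?_
  rw [tsum_eq_single (depth v)]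
  · by_cases h : v ∈ temporalTree p u <;> simp [h]
  · intro k hk
    by_cases h : v ∈ temporalTree p u <;> simp [h, Pi.single_apply, hk.symm]

/-! ### First moments by depth. -/

theorem lintegral_labelLaw_ite_lt {h : ℝ → ℝ} (hc : Continuous h) (h0 : ∀ a, 0 ≤ a → 0 ≤ h a)
    {q : ℝ} (hq : q ∈ Set.Icc (0 : ℝ) 1) :
    ∫⁻ a, (if a < q then ENNReal.ofReal (h a) else 0) ∂labelLaw =
      ENNReal.ofReal (∫ a in (0 : ℝ)..q, h a) := by
  rw [intervalIntegral.integral_of_le hq.1, integral_Ioc_eq_integral_Ioo,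
    ← integral_Ico_eq_integral_Ioo, ofReal_integral_eq_lintegral_ofReal]
  · have : (fun a => if a < q then ENNReal.ofReal (h a) else 0) =
        (Set.Iio q).indicator fun a => ENNReal.ofReal (h a) := by
      ext a; simp [Set.indicator_apply]
    rw [this, lintegral_indicator measurableSet_Iio, labelLaw, Measure.restrict_restrict
      measurableSet_Iio]
    congr 2
    ext a
    simp only [Set.mem_inter_iff, Set.mem_Iio, Set.mem_Icc, Set.mem_Ico]
    constructor
    · rintro ⟨h1, h2, h3⟩; exact ⟨h2, h1⟩
    · rintro ⟨h1, h2⟩; exact ⟨h2, h1, h2.le.trans hq.2⟩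
  · exact (hc.integrableOn_Icc (a := 0) (b := q)).mono_set Set.Ico_subset_Icc_self
  · refine (ae_restrict_iff' measurableSet_Ico).2 (.of_forall fun a ha => h0 a ha.1)

/-- By the root recursion, the mean at depth `k + 1` is `n` times the integral over `a` in `[0, q]`
of the mean at depth `k` started from label `a`. -/
theorem lintegral_weight_single (k : ℕ) {q : ℝ} (hq : q ∈ Set.Icc (0 : ℝ) 1) :
    ∫⁻ u, weight (Pi.single k 1) q u ∂labellingLaw n =
      ENNReal.ofReal ((n * q) ^ k / k.factorial) := by
  induction k generalizing q with
  | zero =>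
    have : ∀ u : Edge n → ℝ, weight (Pi.single 0 1) q u = 1 := by
      intro u
      rw [weight_eq_add_sum]
      simp [weight]
    simp [this]
  | succ k ih =>
    let F : ℝ × (Edge n → ℝ) → ℝ≥0∞ := fun x =>
      if x.1 < q then weight (Pi.single k 1) x.1 x.2 else 0
    have hF : Measurable F := Measurable.ite (measurableSet_lt measurable_fst measurable_const)
      (measurable_weight _) measurable_const
    have h1 : ∀ u : Edge n → ℝ,
        weight (Pi.single (k + 1) 1) q u = ∑ i, F (u ([], i), subLabels i u) := by
      intro u
      rw [weight_eq_add_sum]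
      have : (fun j => (Pi.single (k + 1) 1 : ℕ → ℝ≥0∞) (j + 1)) = Pi.single k 1 := by
        ext j; simp [Pi.single_apply]
      rw [this]
      simp [F]
    simp_rw [h1]
    rw [lintegral_sum_branch hF]
    have h2 : ∫⁻ a, ∫⁻ w, F (a, w) ∂labellingLaw n ∂labelLaw =
        ∫⁻ a, (if a < q then ENNReal.ofReal ((n * a) ^ k / k.factorial) else 0) ∂labelLaw := by
      refine setLIntegral_congr_fun measurableSet_Icc fun a ha => ?_
      simp only [F]
      split_ifs with h
      · exact ih ha
      · simp
    rw [h2, lintegral_labelLaw_ite_lt (by fun_prop) (fun a ha => by positivity) hq,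
      ← ENNReal.ofReal_natCast, ← ENNReal.ofReal_mul (by positivity)]
    congr 1
    simp_rw [mul_pow, mul_div_right_comm, intervalIntegral.integral_const_mul, integral_pow]
    rw [Nat.factorial_succ]
    push_cast
    field_simp
    ring

theorem lintegral_weight_exp (θ : ℝ) {q : ℝ} (hq : q ∈ Set.Icc (0 : ℝ) 1) :
    ∫⁻ u, weight (fun k => ENNReal.ofReal (Real.exp (θ * k))) q u ∂labellingLaw n =
      ENNReal.ofReal (Real.exp (Real.exp θ * (n * q))) := by
  simp_rw [weight_eq_tsum (fun k => ENNReal.ofReal (Real.exp (θ * k)))]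
  rw [lintegral_tsum fun k => ((measurable_weight_right _ _).const_mul _).aemeasurable]
  simp_rw [lintegral_const_mul _ (measurable_weight_right _ _), lintegral_weight_single _ hq]
  have hq0 := hq.1
  have h : ∀ k : ℕ, ENNReal.ofReal (Real.exp (θ * k)) *
      ENNReal.ofReal ((n * q) ^ k / k.factorial) =
      ENNReal.ofReal ((Real.exp θ * (n * q)) ^ k / k.factorial) := by
    intro k
    rw [← ENNReal.ofReal_mul (by positivity), mul_pow (Real.exp θ), ← Real.exp_nat_mul, mul_comm θ, mul_div_assoc]
  simp_rw [h]
  rw [← ENNReal.ofReal_tsum_of_nonneg (fun k => by positivity) (Real.summable_pow_div_factorial _),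
    Real.exp_eq_exp_ℝ, NormedSpace.exp_eq_tsum_div]

/-! ### Laplace transform of the size and its lower tail. -/

/-- The function `x ↦ exp (-x)` on `[0, ∞]`, with value `0` at `∞`. -/
noncomputable def expNeg (x : ℝ≥0∞) : ℝ≥0∞ :=
  if x = ∞ then 0 else ENNReal.ofReal (Real.exp (-x.toReal))

theorem expNeg_zero : expNeg 0 = 1 := by simp [expNeg]

theorem expNeg_add (x y : ℝ≥0∞) : expNeg (x + y) = expNeg x * expNeg y := by
  by_cases hx : x = ∞
  · simp [expNeg, hx]
  by_cases hy : y = ∞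
  · simp [expNeg, hy]
  simp only [expNeg, hx, hy, ENNReal.add_eq_top, or_self, if_false]
  rw [ENNReal.toReal_add hx hy, neg_add, Real.exp_add, ENNReal.ofReal_mul (by positivity)]

theorem expNeg_sum {ι : Type*} (s : Finset ι) (f : ι → ℝ≥0∞) :
    expNeg (∑ i ∈ s, f i) = ∏ i ∈ s, expNeg (f i) := by
  classical
  induction s using Finset.induction_on with
  | empty => simp [expNeg_zero]
  | insert i s hi ih => rw [Finset.sum_insert hi, Finset.prod_insert hi, expNeg_add, ih]

theorem expNeg_le_one (x : ℝ≥0∞) : expNeg x ≤ 1 := by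
  unfold expNeg
  split_ifs
  · simp
  · simp

theorem expNeg_ofReal {x : ℝ} (hx : 0 ≤ x) :
    expNeg (ENNReal.ofReal x) = ENNReal.ofReal (Real.exp (-x)) := by
  simp [expNeg, hx]

theorem le_expNeg_of_le_one {x : ℝ≥0∞} (hx : x ≤ 1) :
    ENNReal.ofReal (Real.exp (-1)) ≤ expNeg x := by
  have hx' : x ≠ ∞ := ne_top_of_le_ne_top ENNReal.one_ne_top hx
  rw [expNeg, if_neg hx']
  gcongr
  exact ENNReal.toReal_le_of_le_ofReal zero_le_one (by simpa using hx)

theorem measurable_expNeg : Measurable expNeg :=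
  Measurable.ite (measurableSet_singleton _) measurable_const (by fun_prop)

/-- The Laplace transform at `t` of the number of vertices of the percolated temporal tree. -/
noncomputable def sizeLaplace (n : ℕ) (t p : ℝ) : ℝ≥0∞ :=
  ∫⁻ u, expNeg (ENNReal.ofReal t * weight (fun _ => 1) p u) ∂labellingLaw n

theorem measurable_expNeg_weight (t : ℝ) : Measurable fun x : ℝ × (Edge n → ℝ) =>
    expNeg (ENNReal.ofReal t * weight (fun _ => 1) x.1 x.2) :=
  measurable_expNeg.comp ((measurable_weight _).const_mul _)

theorem measurable_sizeLaplace (n : ℕ) (t : ℝ) : Measurable (sizeLaplace n t) :=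
  (measurable_expNeg_weight t).lintegral_prod_right'

theorem sizeLaplace_le_one (n : ℕ) (t p : ℝ) : sizeLaplace n t p ≤ 1 :=
  (lintegral_mono fun _ => expNeg_le_one _).trans (by simp)

/-- The root contributes `exp (-t)`; the `n` branches are independent, and a branch whose edge label
is not below `p` is empty and contributes `1`. -/
theorem sizeLaplace_eq (n : ℕ) {t : ℝ} (ht : 0 ≤ t) (p : ℝ) :
    sizeLaplace n t p = ENNReal.ofReal (Real.exp (-t)) *
      (∫⁻ a, (if a < p then sizeLaplace n t a else 1) ∂labelLaw) ^ n := by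
  let F : ℝ × (Edge n → ℝ) → ℝ≥0∞ := fun x =>
    if x.1 < p then expNeg (ENNReal.ofReal t * weight (fun _ => 1) x.1 x.2) else 1
  have hF : Measurable F := Measurable.ite (measurableSet_lt measurable_fst measurable_const)
    (measurable_expNeg_weight t) measurable_const
  have h1 : ∀ u : Edge n → ℝ, expNeg (ENNReal.ofReal t * weight (fun _ => 1) p u) =
      ENNReal.ofReal (Real.exp (-t)) * ∏ i, F (u ([], i), subLabels i u) := by
    intro u
    rw [weight_eq_add_sum, mul_add, expNeg_add, mul_one, expNeg_ofReal ht, Finset.mul_sum,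
      expNeg_sum]
    congr 1
    refine Finset.prod_congr rfl fun i _ => ?_
    simp only [F]
    split_ifs
    · rfl
    · simp [expNeg_zero]
  have hm : Measurable fun u : Edge n → ℝ => ∏ i, F (u ([], i), subLabels i u) :=
    Finset.measurable_fun_prod _ fun i _ => hF.comp (measurePreserving_branch i).measurable
  rw [sizeLaplace]
  simp_rw [h1]
  rw [lintegral_const_mul _ hm, lintegral_prod_branch hF]
  congr 2
  refine lintegral_congr fun a => ?_
  simp only [F]
  split_ifs
  · rfl
  · simp

theorem lintegral_labelLaw_ite_lt_one {f : ℝ → ℝ} (hf : Measurable f) (h0 : ∀ a, 0 ≤ f a)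
    (h1 : ∀ a, f a ≤ 1) {q : ℝ} (hq : q ∈ Set.Icc (0 : ℝ) 1) :
    ∫⁻ a, (if a < q then ENNReal.ofReal (1 - f a) else 1) ∂labelLaw =
      ENNReal.ofReal (1 - ∫ a in (0 : ℝ)..q, f a) := by
  have hb : ∀ a, ‖f a‖ ≤ 1 := fun a => by rw [Real.norm_of_nonneg (h0 a)]; exact h1 a
  have hi : Integrable f labelLaw := Integrable.of_bound hf.aestronglyMeasurable 1 (.of_forall hb)
  have hii : Integrable ((Set.Iio q).indicator f) labelLaw := hi.indicator measurableSet_Iio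
  have h2 : ∀ a, (if a < q then ENNReal.ofReal (1 - f a) else 1) =
      ENNReal.ofReal (1 - (Set.Iio q).indicator f a) := by
    intro a
    by_cases h : a < q <;> simp [h]
  simp_rw [h2]
  rw [← ofReal_integral_eq_lintegral_ofReal (f := fun a => 1 - (Set.Iio q).indicator f a)
    ((integrable_const 1).sub hii)]
  · rw [integral_sub (integrable_const 1) hii, integral_indicator measurableSet_Iio, labelLaw,
      Measure.restrict_restrict measurableSet_Iio, intervalIntegral.integral_of_le hq.1,
      integral_Ioc_eq_integral_Ioo, ← integral_Ico_eq_integral_Ioo]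
    have : Set.Iio q ∩ Set.Icc 0 1 = Set.Ico 0 q := by
      ext a
      simp only [Set.mem_inter_iff, Set.mem_Iio, Set.mem_Icc, Set.mem_Ico]
      constructor
      · rintro ⟨h1, h2, h3⟩; exact ⟨h2, h1⟩
      · rintro ⟨h1, h2⟩; exact ⟨h2, h1, h2.le.trans hq.2⟩
    rw [this]
    simp
  · refine .of_forall fun a => ?_
    by_cases h : a < q <;> simp [h, h1]

/-- With `G = exp (t + n * ∫ f)`, the bound `1 - x ≤ exp (-x)` turns the equation into `1 - f ≤ 1 /
G`. Then `G' = n * f * G ≥ n * (G - 1)`, so `G - 1` grows at least like `exp (n * q)` from its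
initial value `exp t - 1 ≥ t`. -/
theorem one_sub_le_of_integral_equation {f : ℝ → ℝ} (hf : Measurable f) (h0 : ∀ a, 0 ≤ f a)
    (h1 : ∀ a, f a ≤ 1) {t : ℝ} (ht : 0 ≤ t)
    (heq : ∀ q ∈ Set.Icc (0 : ℝ) 1, 1 - f q = Real.exp (-t) * (1 - ∫ a in (0 : ℝ)..q, f a) ^ n)
    {q : ℝ} (hq : q ∈ Set.Icc (0 : ℝ) 1) : 1 - f q ≤ (1 + t * Real.exp (n * q))⁻¹ := by
  have hii : ∀ a b, IntervalIntegrable f volume a b := fun a b =>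
    (intervalIntegrable_const (c := (1 : ℝ))).mono_fun hf.aestronglyMeasurable
      (.of_forall fun x => by simpa [abs_of_nonneg (h0 x)] using h1 x)
  set I : ℝ → ℝ := fun q => ∫ a in (0 : ℝ)..q, f a with hI
  have hIc : Continuous I := intervalIntegral.continuous_primitive hii 0
  -- `f` is only measurable; its continuous version `g`, equal to it on `[0,1]`, makes the primitive
  -- `J` differentiable everywhere.
  set g : ℝ → ℝ := fun q => 1 - Real.exp (-t) * (1 - I q) ^ n with hg
  have hgc : Continuous g := by fun_prop
  have hfg : ∀ q ∈ Set.Icc (0 : ℝ) 1, f q = g q := fun q hq => by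
    simp only [hg, hI]; linarith [heq q hq]
  set J : ℝ → ℝ := fun q => ∫ a in (0 : ℝ)..q, g a with hJ
  have hIJ : ∀ q ∈ Set.Icc (0 : ℝ) 1, I q = J q := by
    intro q hq
    refine intervalIntegral.integral_congr fun a ha => ?_
    rw [Set.uIcc_of_le hq.1] at ha
    exact hfg a ⟨ha.1, ha.2.trans hq.2⟩
  have hJd : ∀ q, HasDerivAt J (g q) q := fun q =>
    intervalIntegral.integral_hasDerivAt_right (hgc.intervalIntegrable _ _)
      (hgc.stronglyMeasurableAtFilter _ _) hgc.continuousAt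
  have hIle : ∀ q ∈ Set.Icc (0 : ℝ) 1, I q ≤ 1 := by
    intro q hq
    have h : I q ≤ ∫ a in (0 : ℝ)..q, (1 : ℝ) :=
      intervalIntegral.integral_mono_on hq.1 (hii _ _) (by simp) fun a _ => h1 a
    simp only [intervalIntegral.integral_const, sub_zero, smul_eq_mul, mul_one] at h
    linarith [hq.2]
  have hgG : ∀ q ∈ Set.Icc (0 : ℝ) 1, 1 - g q ≤ Real.exp (-(t + n * J q)) := by
    intro q hq
    have h2 : (1 - I q) ^ n ≤ Real.exp (-(n * J q)) := by
      rw [← hIJ q hq, ← mul_neg, Real.exp_nat_mul]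
      exact pow_le_pow_left₀ (by linarith [hIle q hq]) (by linarith [Real.add_one_le_exp (-I q)]) n
    rw [hg, sub_sub_cancel, neg_add, Real.exp_add]
    gcongr
  set H : ℝ → ℝ := fun q => (Real.exp (t + n * J q) - 1) * Real.exp (-(n * q)) with hH
  have hHd : ∀ q, HasDerivAt H (Real.exp (t + n * J q) * (n * g q) * Real.exp (-(n * q)) +
      (Real.exp (t + n * J q) - 1) * (Real.exp (-(n * q)) * -(n * 1))) q := fun q =>
    ((((hJd q).const_mul (n : ℝ)).const_add t).exp.sub_const 1).mul
      (((hasDerivAt_id q).const_mul (n : ℝ)).neg.exp)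
  have hmono : MonotoneOn H (Set.Icc 0 1) := by
    refine monotoneOn_of_deriv_nonneg (convex_Icc 0 1)
      (fun q _ => (hHd q).continuousAt.continuousWithinAt)
      (fun q _ => (hHd q).differentiableAt.differentiableWithinAt) fun q hq => ?_
    rw [interior_Icc] at hq
    rw [(hHd q).deriv]
    have h3 := hgG q ⟨hq.1.le, hq.2.le⟩
    have h4 : Real.exp (t + n * J q) * (1 - g q) ≤ 1 := by
      calc _ ≤ Real.exp (t + n * J q) * Real.exp (-(t + n * J q)) := by gcongr
        _ = 1 := by rw [← Real.exp_add]; simp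
    -- This product is the derivative of `H`, rearranged.
    have h5 : 0 ≤ n * Real.exp (-(n * q)) * (1 - Real.exp (t + n * J q) * (1 - g q)) :=
      mul_nonneg (by positivity) (by linarith)
    linarith
  have h6 := hmono ⟨le_rfl, zero_le_one⟩ hq hq.1
  have h7 : J 0 = 0 := by simp [hJ]
  simp only [hH, h7, mul_zero, add_zero, neg_zero, Real.exp_zero, mul_one] at h6
  have h8 : t * Real.exp (n * q) ≤ Real.exp (t + n * J q) - 1 := by
    calc t * Real.exp (n * q) ≤ ((Real.exp (t + n * J q) - 1) * Real.exp (-(n * q))) *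
        Real.exp (n * q) := by
          gcongr
          linarith [Real.add_one_le_exp t]
      _ = _ := by rw [mul_assoc, ← Real.exp_add]; simp
  rw [hfg q hq]
  refine (hgG q hq).trans ?_
  rw [Real.exp_neg]
  have : 0 < 1 + t * Real.exp (n * q) := by positivity
  gcongr
  linarith

theorem sizeLaplace_le (n : ℕ) {t : ℝ} (ht : 0 ≤ t) {q : ℝ} (hq : q ∈ Set.Icc (0 : ℝ) 1) :
    sizeLaplace n t q ≤ ENNReal.ofReal (1 + t * Real.exp (n * q))⁻¹ := by
  have hle : ∀ a, (sizeLaplace n t a).toReal ≤ 1 := fun a =>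
    ENNReal.toReal_le_of_le_ofReal zero_le_one (by simp [sizeLaplace_le_one n t a])
  have hfin : ∀ a, sizeLaplace n t a ≠ ∞ := fun a =>
    ne_top_of_le_ne_top ENNReal.one_ne_top (sizeLaplace_le_one n t a)
  have hf : Measurable fun a => 1 - (sizeLaplace n t a).toReal :=
    (measurable_sizeLaplace n t).ennreal_toReal.const_sub 1
  have h0 : ∀ a, 0 ≤ 1 - (sizeLaplace n t a).toReal := fun a => by linarith [hle a]
  have h1 : ∀ a, 1 - (sizeLaplace n t a).toReal ≤ 1 := fun a => by
    linarith [(sizeLaplace n t a).toReal_nonneg]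
  have := one_sub_le_of_integral_equation (n := n) hf h0 h1 ht ?_ hq
  · rw [← ENNReal.ofReal_toReal (hfin q)]
    exact ENNReal.ofReal_le_ofReal (by linarith)
  · intro r hr
    have h2 := lintegral_labelLaw_ite_lt_one hf h0 h1 hr
    simp only [sub_sub_cancel, ENNReal.ofReal_toReal (hfin _)] at h2
    have hI : 0 ≤ 1 - ∫ a in (0 : ℝ)..r, (1 - (sizeLaplace n t a).toReal) := by
      have : ∫ a in (0 : ℝ)..r, (1 - (sizeLaplace n t a).toReal) ≤ ∫ a in (0 : ℝ)..r, (1 : ℝ) := by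
        refine intervalIntegral.integral_mono_on hr.1 ?_ (by simp) fun a _ => h1 a
        refine (intervalIntegrable_const (c := (1 : ℝ))).mono_fun hf.aestronglyMeasurable
          (.of_forall fun a => ?_)
        simp [abs_of_nonneg (h0 a)]
      simp only [intervalIntegral.integral_const, sub_zero, smul_eq_mul, mul_one] at this
      linarith [hr.2]
    rw [sub_sub_cancel, sizeLaplace_eq n ht, h2, ← ENNReal.ofReal_pow hI,
      ← ENNReal.ofReal_mul (by positivity), ENNReal.toReal_ofReal (by positivity)]

theorem labellingLaw_weight_le (n : ℕ) {q : ℝ} (hq : q ∈ Set.Icc (0 : ℝ) 1) (s : ℝ) :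
    labellingLaw n {u | weight (fun _ => 1) q u ≤ ENNReal.ofReal (Real.exp (n * q - s))} ≤
      ENNReal.ofReal (Real.exp (1 - s)) := by
  -- With this `t`, the exponent is at most `1` on the event, while the Laplace bound becomes `1 /
  -- (1 + exp s) ≤ exp (-s)`.
  set t := Real.exp (s - n * q) with ht
  have h1 : {u : Edge n → ℝ | weight (fun _ => 1) q u ≤ ENNReal.ofReal (Real.exp (n * q - s))} ⊆
      {u | ENNReal.ofReal (Real.exp (-1)) ≤
        expNeg (ENNReal.ofReal t * weight (fun _ => 1) q u)} := by
    intro u hu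
    refine le_expNeg_of_le_one ?_
    calc ENNReal.ofReal t * weight (fun _ => 1) q u
        ≤ ENNReal.ofReal t * ENNReal.ofReal (Real.exp (n * q - s)) := by gcongr; exact hu
      _ = 1 := by
        rw [← ENNReal.ofReal_mul (by positivity), ht, ← Real.exp_add]; simp
  refine (measure_mono h1).trans ?_
  have hm : Measurable fun u : Edge n → ℝ =>
    expNeg (ENNReal.ofReal t * weight (fun _ => 1) q u) :=
    (measurable_expNeg_weight t).comp measurable_prodMk_left
  have h2 := meas_ge_le_lintegral_div (μ := labellingLaw n) hm.aemeasurable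
    (ε := ENNReal.ofReal (Real.exp (-1))) (by simp [Real.exp_pos]) ENNReal.ofReal_ne_top
  refine h2.trans ?_
  rw [ENNReal.div_le_iff (by simp [Real.exp_pos]) ENNReal.ofReal_ne_top,
    ← ENNReal.ofReal_mul (by positivity), ← Real.exp_add]
  refine (sizeLaplace_le n (by positivity) hq).trans (ENNReal.ofReal_le_ofReal ?_)
  rw [ht, ← Real.exp_add, sub_add_cancel]
  have : 1 - s + -1 = -s := by ring
  rw [this, Real.exp_neg]
  gcongr
  linarith

/-! ### From vertex counts to the uniformly chosen vertex. -/

theorem weight_mono {g h : ℕ → ℝ≥0∞} (hgh : ∀ k, g k ≤ h k) (p : ℝ) (u : Edge n → ℝ) :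
    weight g p u ≤ weight h p u :=
  ENNReal.tsum_le_tsum fun _ => Set.indicator_le_indicator (hgh _)

theorem weight_add (g h : ℕ → ℝ≥0∞) (p : ℝ) (u : Edge n → ℝ) :
    weight (fun k => g k + h k) p u = weight g p u + weight h p u := by
  rw [weight, weight, weight, ← ENNReal.tsum_add]
  exact tsum_congr fun v => congrFun (Set.indicator_add _ _ _) v

theorem weight_const_mul (c : ℝ≥0∞) (g : ℕ → ℝ≥0∞) (p : ℝ) (u : Edge n → ℝ) :
    weight (fun k => c * g k) p u = c * weight g p u := by
  rw [weight, weight, ← ENNReal.tsum_mul_left]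
  exact tsum_congr fun v => Set.indicator_const_mul _ _ c v

theorem weight_one_eq_encard (p : ℝ) (u : Edge n → ℝ) :
    weight (fun _ => 1) p u = (temporalTree p u).encard := by
  rw [weight, ← Measure.count_apply (.of_discrete), ← lintegral_indicator_one (.of_discrete),
    lintegral_count]
  rfl

theorem uniformOn_temporalTree_singleton (p : ℝ) (u : Edge n → ℝ) (v : Vertex n) :
    uniformOn (temporalTree p u) {v} =
      (weight (fun _ => 1) p u)⁻¹ * (temporalTree p u).indicator 1 v := by
  rw [uniformOn, cond_apply .of_discrete, Measure.count_apply .of_discrete,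
    Measure.count_apply .of_discrete, ← weight_one_eq_encard]
  congr 1
  by_cases h : v ∈ temporalTree p u
  · rw [Set.inter_eq_right.2 (by simpa using h)]; simp [h]
  · rw [Set.inter_singleton_eq_empty.2 h]; simp [h]

variable {Ω : Type*} [MeasurableSpace Ω] {μ : Measure Ω} {U : Ω → Edge n → ℝ}
  {V : Ω → Vertex n} {p : ℝ}

theorem IsUniformVertex.measure_depth_mem (hU : IsUniformLabelling μ U)
    (hV : IsUniformVertex p μ U V) (S : Set ℕ) :
    μ {ω | depth (V ω) ∈ S} = ∫⁻ u, (weight (fun _ => 1) p u)⁻¹ *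
      weight (S.indicator 1) p u ∂labellingLaw n := by
  have h1 : ∀ v, μ (V ⁻¹' {v}) = ∫⁻ ω, uniformOn (temporalTree p (U ω)) {v} ∂μ := by
    intro v
    simpa using hV.condLaw Set.univ .univ v
  have h2 : {ω | depth (V ω) ∈ S} = ⋃ v ∈ {v : Vertex n | depth v ∈ S}, V ⁻¹' {v} := by
    ext; simp
  have h3 : ∀ v, Measurable fun u : Edge n → ℝ => uniformOn (temporalTree p u) {v} := by
    intro v
    simp_rw [uniformOn_temporalTree_singleton]
    refine (measurable_weight_right _ p).inv.mul ?_
    exact Measurable.ite (measurable_prodMk_left (measurableSet_hasDecreasingPath v))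
      measurable_const measurable_const
  rw [h2, measure_biUnion (Set.to_countable _)
    (fun v _ w _ hvw => Disjoint.preimage _ (by simpa using hvw))
    (fun v _ => hV.measurable .of_discrete)]
  simp_rw [h1]
  rw [tsum_subtype {v : Vertex n | depth v ∈ S}
    (fun v => ∫⁻ ω, uniformOn (temporalTree p (U ω)) {v} ∂μ)]
  have h4 : ∀ v, {v : Vertex n | depth v ∈ S}.indicator
      (fun v => ∫⁻ ω, uniformOn (temporalTree p (U ω)) {v} ∂μ) v =
      ∫⁻ u, S.indicator 1 (depth v) * uniformOn (temporalTree p u) {v} ∂labellingLaw n := by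
    intro v
    rw [lintegral_const_mul _ (h3 v), ← hU.map_eq, lintegral_map (h3 v) hU.measurable]
    by_cases h : depth v ∈ S <;> simp [h]
  simp_rw [h4]
  rw [← lintegral_tsum fun v => ((h3 v).const_mul _).aemeasurable]
  refine lintegral_congr fun u => ?_
  rw [weight.eq_def (S.indicator 1), ← ENNReal.tsum_mul_left]
  refine tsum_congr fun v => ?_
  rw [uniformOn_temporalTree_singleton]
  by_cases h : v ∈ temporalTree p u <;> simp [h, mul_comm]

/-- The conditional probability is a ratio of counts: bounded by `1` when the size is at most `K`,
and by the numerator over `K` otherwise. -/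
theorem IsUniformVertex.measure_depth_mem_le (hU : IsUniformLabelling μ U)
    (hV : IsUniformVertex p μ U V) (S : Set ℕ) {K : ℝ≥0∞} :
    μ {ω | depth (V ω) ∈ S} ≤ labellingLaw n {u | weight (fun _ => 1) p u ≤ K} +
      K⁻¹ * ∫⁻ u, weight (S.indicator 1) p u ∂labellingLaw n := by
  have hm : MeasurableSet {u : Edge n → ℝ | weight (fun _ => 1) p u ≤ K} :=
    measurableSet_le (measurable_weight_right _ p) measurable_const
  rw [hV.measure_depth_mem hU, ← lintegral_indicator_one hm,
    ← lintegral_const_mul _ (measurable_weight_right _ p),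
    ← lintegral_add_left (measurable_one.indicator hm)]
  refine lintegral_mono fun u => ?_
  by_cases h : weight (fun _ => 1) p u ≤ K
  · rw [Set.indicator_of_mem (by exact h)]
    refine le_add_right ?_
    have : weight (S.indicator 1) p u ≤ weight (fun _ => 1) p u :=
      weight_mono (fun k => Set.indicator_le_self' (by simp) k) p u
    calc _ ≤ (weight (fun _ => 1) p u)⁻¹ * weight (fun _ => 1) p u := by gcongr
      _ ≤ 1 := ENNReal.inv_mul_le_one _
  · refine le_add_left ?_
    gcongr
    exact (not_le.1 h).le

/-! ### Concentration of the depth. -/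

/-- A two-sided Chernoff bound: each tail indicator is dominated by an exponential of slope `θ` or
`-θ`. Since `exp (±θ) ≤ 1 ± θ + θ ^ 2`, each exponent is at most `m * (1 + θ ^ 2 - θ * ε)`, and `2 *
θ ≤ ε` leaves a gain of `m * θ ^ 2`. -/
theorem lintegral_weight_deviation_le (hn : n ≠ 0) (hp : p ∈ Set.Ioc (0 : ℝ) 1) {ε θ : ℝ}
    (hθ0 : 0 ≤ θ) (hθ1 : θ ≤ 1) (hθε : 2 * θ ≤ ε) :
    ∫⁻ u, weight ({k : ℕ | ε ≤ |(k : ℝ) / (n * p) - 1|}.indicator 1) p u ∂labellingLaw n ≤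
      ENNReal.ofReal (2 * Real.exp (n * p - n * p * θ ^ 2)) := by
  set m : ℝ := n * p with hm
  have hm0 : 0 < m := mul_pos (by positivity) hp.1
  set c₁ : ℝ≥0∞ := ENNReal.ofReal (Real.exp (-(θ * (1 + ε) * m)))
  set c₂ : ℝ≥0∞ := ENNReal.ofReal (Real.exp (θ * (1 - ε) * m))
  have hdom : ∀ k : ℕ, {k : ℕ | ε ≤ |(k : ℝ) / m - 1|}.indicator (1 : ℕ → ℝ≥0∞) k ≤
      c₁ * ENNReal.ofReal (Real.exp (θ * k)) + c₂ * ENNReal.ofReal (Real.exp (-θ * k)) := by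
    intro k
    refine Set.indicator_apply_le' (fun hk => ?_) fun _ => zero_le
    rw [← ENNReal.ofReal_mul (by positivity), ← ENNReal.ofReal_mul (by positivity),
      ← Real.exp_add, ← Real.exp_add]
    rcases le_abs.1 (show ε ≤ |(k : ℝ) / m - 1| from hk) with h | h
    · refine le_add_right ?_
      rw [Pi.one_apply, ENNReal.one_le_ofReal, Real.one_le_exp_iff]
      have h' : (1 + ε) * m ≤ k := by rw [← le_div_iff₀ hm0]; linarith
      nlinarith [mul_le_mul_of_nonneg_left h' hθ0]
    · refine le_add_left ?_
      rw [Pi.one_apply, ENNReal.one_le_ofReal, Real.one_le_exp_iff]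
      have h' : (k : ℝ) ≤ (1 - ε) * m := by rw [← div_le_iff₀ hm0]; linarith
      nlinarith [mul_le_mul_of_nonneg_left h' hθ0]
  have hp' : p ∈ Set.Icc (0 : ℝ) 1 := ⟨hp.1.le, hp.2⟩
  refine (lintegral_mono fun u => weight_mono hdom p u).trans ?_
  simp_rw [weight_add, weight_const_mul]
  rw [lintegral_add_left ((measurable_weight_right _ p).const_mul _),
    lintegral_const_mul _ (measurable_weight_right _ p),
    lintegral_const_mul _ (measurable_weight_right _ p), lintegral_weight_exp θ hp',
    lintegral_weight_exp (-θ) hp', ← hm, ← ENNReal.ofReal_mul (by positivity),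
    ← ENNReal.ofReal_mul (by positivity), ← ENNReal.ofReal_add (by positivity) (by positivity),
    ← Real.exp_add, ← Real.exp_add, two_mul]
  have h1 := (abs_le.1 (Real.abs_exp_sub_one_sub_id_le (x := θ) (by rwa [abs_of_nonneg hθ0]))).2
  have h2 := (abs_le.1 (Real.abs_exp_sub_one_sub_id_le (x := -θ)
    (by rwa [abs_neg, abs_of_nonneg hθ0]))).2
  have h3 : 2 * θ ^ 2 ≤ θ * ε := by nlinarith
  refine ENNReal.ofReal_le_ofReal (add_le_add (Real.exp_le_exp.2 ?_) (Real.exp_le_exp.2 ?_))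
  · have : Real.exp θ ≤ 1 - θ ^ 2 + θ * (1 + ε) := by linarith
    nlinarith [mul_le_mul_of_nonneg_right this hm0.le]
  · have : Real.exp (-θ) ≤ 1 - θ ^ 2 - θ * (1 - ε) := by nlinarith
    nlinarith [mul_le_mul_of_nonneg_right this hm0.le]

theorem IsUniformVertex.measure_depth_deviation_le (hn : n ≠ 0) (hp : p ∈ Set.Ioc (0 : ℝ) 1)
    (hU : IsUniformLabelling μ U) (hV : IsUniformVertex p μ U V) {ε θ : ℝ}
    (hθ0 : 0 ≤ θ) (hθ1 : θ ≤ 1) (hθε : 2 * θ ≤ ε) :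
    μ {ω | ε ≤ |(depth (V ω) : ℝ) / (n * p) - 1|} ≤
      ENNReal.ofReal ((Real.exp 1 + 2) * Real.exp (-(n * (p * θ ^ 2 / 2)))) := by
  -- Half of the Chernoff gain: the threshold `exp (n * p - s)` then makes both error terms of order
  -- `exp (-s)`.
  set s : ℝ := n * (p * θ ^ 2 / 2) with hs
  refine (hV.measure_depth_mem_le hU {k : ℕ | ε ≤ |(k : ℝ) / (n * p) - 1|}
    (K := ENNReal.ofReal (Real.exp (n * p - s)))).trans ?_
  refine (add_le_add (labellingLaw_weight_le n ⟨hp.1.le, hp.2⟩ s)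
    (mul_le_mul_right (lintegral_weight_deviation_le hn hp hθ0 hθ1 hθε) _)).trans ?_
  rw [← ENNReal.ofReal_inv_of_pos (by positivity), ← Real.exp_neg,
    ← ENNReal.ofReal_mul (by positivity), ← ENNReal.ofReal_add (by positivity) (by positivity)]
  refine ENNReal.ofReal_le_ofReal (le_of_eq ?_)
  rw [mul_left_comm, ← Real.exp_add, add_mul, ← Real.exp_add]
  congr 3
  rw [hs]; ring

/-! ### Comparison with the logarithm of the size. -/

theorem labellingLaw_le_weight (n : ℕ) {q : ℝ} (hq : q ∈ Set.Icc (0 : ℝ) 1) (s : ℝ) :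
    labellingLaw n {u | ENNReal.ofReal (Real.exp (n * q + s)) ≤ weight (fun _ => 1) q u} ≤
      ENNReal.ofReal (Real.exp (-s)) := by
  have h := meas_ge_le_lintegral_div (μ := labellingLaw n)
    (measurable_weight_right (fun _ => 1) q).aemeasurable
    (ε := ENNReal.ofReal (Real.exp (n * q + s))) (by simp [Real.exp_pos]) ENNReal.ofReal_ne_top
  have h1 := lintegral_weight_exp (n := n) 0 hq
  simp only [zero_mul, Real.exp_zero, ENNReal.ofReal_one, one_mul] at h1
  rw [h1, ← ENNReal.ofReal_div_of_pos (by positivity), ← Real.exp_sub] at h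
  simpa using h

/-- Both `x` and `y` are within `δ * m` of `m`, so they differ by less than `2 * δ * m`, while `y >
m / 2`; hence the constant `4`. -/
theorem abs_div_sub_one_lt {x y m δ ε : ℝ} (hm : 0 < m) (hδ : δ < 1 / 2) (hε : 4 * δ ≤ ε)
    (hx : |x / m - 1| < δ) (hy₁ : (1 - δ) * m < y) (hy₂ : y < (1 + δ) * m) :
    |x / y - 1| < ε := by
  have hδ0 : 0 < δ := (abs_nonneg _).trans_lt hx
  have hy : 0 < y := by nlinarith
  have hx' : |x - m| < δ * m := by
    have : x - m = (x / m - 1) * m := by field_simp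
    rw [this, abs_mul, abs_of_pos hm]
    gcongr
  have hxy : |x - y| < 2 * δ * m := by
    rw [abs_lt] at hx' ⊢
    constructor <;> linarith
  have : x / y - 1 = (x - y) / y := by field_simp
  rw [this, abs_div, abs_of_pos hy, div_lt_iff₀ hy]
  nlinarith

theorem IsUniformLabelling.measure_depth_div_log_le (hn : n ≠ 0) (hp : p ∈ Set.Ioc (0 : ℝ) 1)
    (hU : IsUniformLabelling μ U) {ε δ : ℝ} (hδ : δ < 1 / 2) (hε : 4 * δ ≤ ε) :
    μ {ω | ε ≤ |(depth (V ω) : ℝ) / Real.log ((temporalTree p (U ω)).ncard : ℝ) - 1|} ≤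
      μ {ω | δ ≤ |(depth (V ω) : ℝ) / (n * p) - 1|} +
      (ENNReal.ofReal (Real.exp 1 * Real.exp (-(n * (p * δ)))) +
        ENNReal.ofReal (1 * Real.exp (-(n * (p * δ))))) := by
  have hm0 : 0 < (n : ℝ) * p := mul_pos (by positivity) hp.1
  have hp' : p ∈ Set.Icc (0 : ℝ) 1 := ⟨hp.1.le, hp.2⟩
  have hA : MeasurableSet {u : Edge n → ℝ | weight (fun _ => 1) p u ≤
      ENNReal.ofReal (Real.exp (n * p - n * (p * δ)))} :=
    measurableSet_le (measurable_weight_right _ p) measurable_const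
  have hB : MeasurableSet {u : Edge n → ℝ | ENNReal.ofReal (Real.exp (n * p + n * (p * δ))) ≤
      weight (fun _ => 1) p u} :=
    measurableSet_le measurable_const (measurable_weight_right _ p)
  have h1 := labellingLaw_weight_le n hp' (n * (p * δ))
  have h2 := labellingLaw_le_weight n hp' (n * (p * δ))
  rw [← hU.map_eq, Measure.map_apply hU.measurable hA, sub_eq_add_neg 1, Real.exp_add] at h1
  rw [← hU.map_eq, Measure.map_apply hU.measurable hB] at h2
  rw [one_mul]
  refine le_trans ?_ (add_le_add le_rfl (add_le_add h1 h2))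
  refine le_trans (measure_mono ?_) ((measure_union_le _ _).trans
    (add_le_add le_rfl (measure_union_le _ _)))
  intro ω hω
  by_contra hc
  simp only [Set.mem_union, Set.mem_preimage, Set.mem_ofPred_eq, not_or, not_le] at hc hω
  obtain ⟨hc1, hc2, hc3⟩ := hc
  rw [weight_one_eq_encard] at hc2 hc3
  -- Finiteness comes from the upper bound on the size; it is needed because `ncard` of an infinite
  -- set is `0`.
  have hfin : (temporalTree p (U ω)).Finite := by
    rw [← Set.encard_ne_top_iff]
    intro h
    simp [h] at hc3
  have hcast : ((temporalTree p (U ω)).encard : ℝ≥0∞) =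
      ENNReal.ofReal ((temporalTree p (U ω)).ncard : ℝ) := by
    rw [← hfin.cast_ncard_eq]; simp
  rw [hcast] at hc2 hc3
  have hc2' := (ENNReal.ofReal_lt_ofReal_iff_of_nonneg (by positivity)).1 hc2
  have hc3' := (ENNReal.ofReal_lt_ofReal_iff (by positivity)).1 hc3
  have hpos : 0 < ((temporalTree p (U ω)).ncard : ℝ) := (Real.exp_pos _).trans hc2'
  refine absurd hω (not_le.2 (abs_div_sub_one_lt hm0 hδ hε hc1 ?_ ?_))
  · have := (Real.lt_log_iff_exp_lt hpos).2 hc2'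
    linarith
  · have := (Real.log_lt_iff_lt_exp hpos).2 hc3'
    linarith

theorem tendsto_ofReal_mul_exp_neg (C : ℝ) {c : ℝ} (hc : 0 < c) :
    Tendsto (fun n : ℕ => ENNReal.ofReal (C * Real.exp (-(n * c)))) atTop (𝓝 0) := by
  have h : Tendsto (fun n : ℕ => (n : ℝ) * c) atTop atTop :=
    tendsto_natCast_atTop_atTop.atTop_mul_const hc
  simpa using ENNReal.tendsto_ofReal ((Real.tendsto_exp_neg_atTop_nhds_zero.comp h).const_mul C)

end UniformTemporalTree

theorem theorem3 (p : ℝ) (hp : p ∈ Set.Ioc (0 : ℝ) 1)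
    {Ω : ℕ → Type*} [∀ n, MeasurableSpace (Ω n)]
    (μ : ∀ n, Measure (Ω n)) [∀ n, IsProbabilityMeasure (μ n)]
    (U : ∀ n, Ω n → UniformTemporalTree.Edge n → ℝ)
    (hU : ∀ n, UniformTemporalTree.IsUniformLabelling (μ n) (U n))
    (V : ∀ n, Ω n → UniformTemporalTree.Vertex n)
    (hV : ∀ n, UniformTemporalTree.IsUniformVertex p (μ n) (U n) (V n)) :
    UniformTemporalTree.TendstoInProbability μ
      (fun n ω => (UniformTemporalTree.depth (V n ω) : ℝ) / ((n : ℝ) * p)) 1 ∧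
    UniformTemporalTree.TendstoInProbability μ
      (fun n ω => (UniformTemporalTree.depth (V n ω) : ℝ) /
        Real.log ((UniformTemporalTree.temporalTree p (U n ω)).ncard : ℝ)) 1 := by
  have h1 : UniformTemporalTree.TendstoInProbability μ
      (fun n ω => (UniformTemporalTree.depth (V n ω) : ℝ) / ((n : ℝ) * p)) 1 := by
    intro ε hε
    -- The largest `θ` of this form allowed by `2 * θ ≤ ε`; the cap at `1` keeps `θ ≤ 1`.
    have hθ : 0 < min ε 1 / 2 := by positivity
    refine tendsto_of_tendsto_of_tendsto_of_le_of_le' tendsto_const_nhds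
      (UniformTemporalTree.tendsto_ofReal_mul_exp_neg (Real.exp 1 + 2)
        (c := p * (min ε 1 / 2) ^ 2 / 2) (by have := hp.1; positivity))
      (.of_forall fun _ => zero_le) ?_
    filter_upwards [eventually_ne_atTop 0] with n hn
    exact (hV n).measure_depth_deviation_le hn hp (hU n) hθ.le
      (by linarith [min_le_right ε 1]) (by linarith [min_le_left ε 1])
  refine ⟨h1, fun ε hε => ?_⟩
  have hδ : 0 < min ε 1 / 4 := by positivity
  have hlim := (h1 _ hδ).add
    ((UniformTemporalTree.tendsto_ofReal_mul_exp_neg (Real.exp 1) (mul_pos hp.1 hδ)).add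
      (UniformTemporalTree.tendsto_ofReal_mul_exp_neg 1 (mul_pos hp.1 hδ)))
  simp only [add_zero] at hlim
  refine tendsto_of_tendsto_of_tendsto_of_le_of_le' tendsto_const_nhds hlim
    (.of_forall fun _ => zero_le) ?_
  filter_upwards [eventually_ne_atTop 0] with n hn
  exact (hU n).measure_depth_div_log_le hn hp
    (by linarith [min_le_right ε 1]) (by linarith [min_le_left ε 1])
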